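/- Call a finite set $A$ of integers *sumset-distinct modulo $N$* if all subsets of $A$ (including the empty set) have pairwise distinct sums modulo $N$. Let $n \ge 1$ be an integer, let $N = 2^n+1$ or $N = 2^n+3$, and let $A$ be a set of exactly $n$ integers. Then $A$ is sumset-distinct modulo $N$ if and only if there are an integer $\lambda$ with $\gcd(\lambda, N) = 1$ and signs $\varepsilon_0, \dots, \varepsilon_{n-1} \in \{1,-1\}$ such that $$\{a \bmod N : a \in A\} = \{\varepsilon_i \lambda 2^i \bmod N : 0 \le i \le n-1\}.$$ -/

import Mathlib

/-- A finite set `A` of integers is sumset-distinct modulo `N` if all subsets of `A`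
(including the empty set) have pairwise distinct sums modulo `N`. -/
def SumsetDistinctMod (N : ℕ) (A : Finset ℤ) : Prop :=
  ∀ B C : Finset ℤ, B ⊆ A → C ⊆ A → (∑ x ∈ B, x) ≡ (∑ x ∈ C, x) [ZMOD (N : ℤ)] → B = C

/-- The reduction modulo `N` of a finite set of integers, as a set of residue classes. -/
def residuesMod (N : ℕ) (A : Finset ℤ) : Finset (ZMod N) :=
  A.image (fun a : ℤ => (a : ZMod N))

/-- The set of integers `{± l * 2 ^ 0, ± l * 2 ^ 1, …, ± l * 2 ^ (n - 1)}`, where the sign of the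
`i`-th element is `ε i ∈ ℤˣ = {1, -1}`. -/
def signedDilatedPowers (n : ℕ) (l : ℤ) (ε : Fin n → ℤˣ) : Finset ℤ :=
  Finset.univ.image (fun i : Fin n => ((ε i : ℤˣ) : ℤ) * l * 2 ^ (i : ℕ))

/-! Let `S` be the set of the `2 ^ n` subset sums; it misses one or three residues. Complementing
subsets makes `S` symmetric under `x ↦ s - x`, with `s` the total sum, and `s / 2` is missing, so
three missing residues form a progression `r - d, r, r + d`. Summing a nontrivial additive character
`ψ` over all residues gives `∏ (1 + ψ (a i)) + ∑ ψ x = 0`, with `x` running over the missing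
residues. Characters with values in characteristic 2 and 3 then show that the summands and `d` are
units.

Changing signs translates `S`, and multiplying by a unit dilates it; so `S` may be taken to be the
interval `0, …, 2 ^ n - 1` (`DistinctSums.exists_signs_of_mem`). If some summand is `1`, the other
summands have exactly the even elements as sums; halving them gives the same situation with `n - 1`,
and induction yields the powers of `2` (`DistinctSums.image_eq_two_pow`).

It remains to find the summand `1`. After the first halving the interval is at most half of the
circle and nothing wraps. At the top level, one missing residue allows dilating by a summand, while
three missing residues need the gap analysis of `DistinctSums.exists_eq_one_of_add_three`. -/

theorem ZMod.natCast_eq_neg_natCast_iff {N v i : ℕ} (hv : v < N) (hi : 0 < i) (hiN : i ≤ N) :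
    (v : ZMod N) = -(i : ZMod N) ↔ v + i = N := by
  rw [eq_neg_iff_add_eq_zero, ← Nat.cast_add, ZMod.natCast_eq_zero_iff]
  constructor
  · rintro ⟨q, hq⟩
    have h1 : q < 2 := by
      by_contra h1
      have : N * 2 ≤ N * q := Nat.mul_le_mul_left N (not_lt.1 h1)
      omega
    have h2 : q ≠ 0 := by rintro rfl; omega
    rw [hq, show q = 1 by omega, mul_one]
  · intro h
    rw [h]

/-! ### Distinct subset sums under dilation and sign change. -/

/-- The family `a` has distinct sums over the subsets of `I`. -/
def DistinctSums {ι R : Type*} [AddCommMonoid R] (I : Finset ι) (a : ι → R) : Prop :=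
  ∀ ⦃B C : Finset ι⦄, B ⊆ I → C ⊆ I → ∑ i ∈ B, a i = ∑ i ∈ C, a i → B = C

/-- The set of all sums of `a` over subsets of `I`. -/
def subsetSums {ι R : Type*} [AddCommMonoid R] [DecidableEq R] (I : Finset ι) (a : ι → R) :
    Finset R :=
  I.powerset.image fun C => ∑ i ∈ C, a i

theorem mem_subsetSums {ι R : Type*} [AddCommMonoid R] [DecidableEq R] {I : Finset ι}
    {a : ι → R} {x : R} : x ∈ subsetSums I a ↔ ∃ C ⊆ I, ∑ i ∈ C, a i = x := by
  simp [subsetSums]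

theorem DistinctSums.card_subsetSums {ι R : Type*} [AddCommMonoid R] [DecidableEq R]
    {I : Finset ι} {a : ι → R} (h : DistinctSums I a) : (subsetSums I a).card = 2 ^ I.card := by
  rw [subsetSums, Finset.card_image_of_injOn, Finset.card_powerset]
  intro B hB C hC hBC
  exact h (Finset.mem_powerset.1 hB) (Finset.mem_powerset.1 hC) hBC

theorem DistinctSums.injOn {ι R : Type*} [AddCommMonoid R] {I : Finset ι} {a : ι → R}
    (h : DistinctSums I a) : Set.InjOn a I := by
  intro i hi j hj hij
  have := h (B := {i}) (C := {j}) (by simpa using hi) (by simpa using hj) (by simpa using hij)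
  simpa using this

theorem distinctSums_iff_image {ι R : Type*} [AddCommMonoid R] [DecidableEq R] [DecidableEq ι]
    {I : Finset ι} {a : ι → R} (ha : Set.InjOn a I) :
    DistinctSums I a ↔ DistinctSums (I.image a) (id : R → R) := by
  have key : ∀ B ⊆ I, ∑ x ∈ B.image a, id x = ∑ i ∈ B, a i := fun B hB =>
    Finset.sum_image (f := id) (ha.mono (Finset.coe_subset.2 hB))
  constructor
  · intro h B C hB hC hBC
    obtain ⟨B, hB', rfl⟩ := Finset.subset_image_iff.1 hB
    obtain ⟨C, hC', rfl⟩ := Finset.subset_image_iff.1 hC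
    rw [key B hB', key C hC'] at hBC
    rw [h hB' hC' hBC]
  · intro h B C hB hC hBC
    rw [← key B hB, ← key C hC] at hBC
    have h' := h (Finset.image_subset_image hB) (Finset.image_subset_image hC) hBC
    have h2 : a '' (B : Set ι) = a '' (C : Set ι) := by
      rw [← Finset.coe_image, ← Finset.coe_image, h']
    exact Finset.coe_injective ((ha.image_eq_image_iff (Finset.coe_subset.2 hB)
      (Finset.coe_subset.2 hC)).1 h2)

theorem DistinctSums.mono {ι R : Type*} [AddCommMonoid R] {I J : Finset ι} {a : ι → R}
    (h : DistinctSums I a) (hJ : J ⊆ I) : DistinctSums J a :=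
  fun _ _ hB hC => h (hB.trans hJ) (hC.trans hJ)

theorem DistinctSums.unit_mul {ι R : Type*} [CommRing R] {I : Finset ι} {a : ι → R} {u : R}
    (hu : IsUnit u) (h : DistinctSums I a) : DistinctSums I fun i => u * a i := by
  intro B C hB hC hBC
  rw [← Finset.mul_sum, ← Finset.mul_sum] at hBC
  exact h hB hC (hu.mul_left_cancel hBC)

theorem mem_subsetSums_unit_mul {ι R : Type*} [CommRing R] [DecidableEq R] {I : Finset ι}
    {a : ι → R} {u : R} (hu : IsUnit u) {x : R} :
    u * x ∈ subsetSums I (fun i => u * a i) ↔ x ∈ subsetSums I a := by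
  simp only [mem_subsetSums, ← Finset.mul_sum, hu.mul_right_inj]

/-- Changing the sign of `a` on `C` translates subset sums by `- ∑ i ∈ C, a i`. -/
theorem sum_flip {ι R : Type*} [DecidableEq ι] [AddCommGroup R] (a : ι → R) (C D : Finset ι) :
    ∑ i ∈ D, (if i ∈ C then -a i else a i) = ∑ i ∈ symmDiff D C, a i - ∑ i ∈ C, a i := by
  have h1 : symmDiff D C = (D \ C) ∪ (C \ D) := rfl
  have h2 : Disjoint (D \ C) (C \ D) := disjoint_sdiff_sdiff
  rw [h1, Finset.sum_union h2, Finset.sum_ite, Finset.filter_mem_eq_inter,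
    Finset.filter_notMem_eq_sdiff, Finset.sum_neg_distrib,
    ← Finset.sum_inter_add_sum_sdiff C D a, Finset.inter_comm D C]
  abel

theorem DistinctSums.flip {ι R : Type*} [DecidableEq ι] [AddCommGroup R] {I C : Finset ι}
    {a : ι → R} (hC : C ⊆ I) (h : DistinctSums I a) :
    DistinctSums I fun i => if i ∈ C then -a i else a i := by
  intro B D hB hD hBD
  simp only [sum_flip, sub_left_inj] at hBD
  have hs : ∀ {E : Finset ι}, E ⊆ I → symmDiff E C ⊆ I := fun hE =>
    (Finset.symmDiff_subset_union).trans (Finset.union_subset hE hC)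
  exact symmDiff_left_injective C (h (hs hB) (hs hD) hBD)

theorem mem_subsetSums_flip {ι R : Type*} [DecidableEq ι] [AddCommGroup R] [DecidableEq R]
    {I C : Finset ι} {a : ι → R} (hC : C ⊆ I) {x : R} :
    x ∈ subsetSums I (fun i => if i ∈ C then -a i else a i) ↔
      x + ∑ i ∈ C, a i ∈ subsetSums I a := by
  have hs : ∀ {E : Finset ι}, E ⊆ I → symmDiff E C ⊆ I := fun hE =>
    (Finset.symmDiff_subset_union).trans (Finset.union_subset hE hC)
  simp only [mem_subsetSums, sum_flip, sub_eq_iff_eq_add]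
  constructor
  · rintro ⟨D, hD, h⟩
    exact ⟨_, hs hD, h⟩
  · rintro ⟨D, hD, h⟩
    exact ⟨symmDiff D C, hs hD, by simpa [symmDiff_assoc] using h⟩

/-! ### From an interval of sums to the powers of `2`. -/

/-- If the subset sums fill an interval of length `2 ^ |I|` and one of the summands is `1`, then
the sums over the other summands are the even elements of the interval. -/
theorem DistinctSums.two_mul_mem_subsetSums_erase {ι : Type*} [DecidableEq ι] {N : ℕ}
    {I : Finset ι} {a : ι → ZMod N} (h : DistinctSums I a)
    (hS : ∀ t : ℕ, t < 2 ^ I.card → (t : ZMod N) ∈ subsetSums I a) {b : ι} (hb : b ∈ I) (hb1 : a b = 1)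
    {t : ℕ} (ht : 2 * t < 2 ^ I.card) :
    ((2 * t : ℕ) : ZMod N) ∈ subsetSums (I.erase b) a := by
  induction t with
  | zero => exact mem_subsetSums.2 ⟨∅, by simp, by simp⟩
  | succ t ih =>
    obtain ⟨C, hC, hCt⟩ := mem_subsetSums.1 (ih (by omega))
    obtain ⟨D, hD, hDt⟩ := mem_subsetSums.1 (hS _ ht)
    refine mem_subsetSums.2 ⟨D, Finset.subset_erase.2 ⟨hD, fun hbD => ?_⟩, hDt⟩
    have hbC : b ∉ C := fun hbC => absurd (hC hbC) (Finset.notMem_erase b I)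
    -- If `b ∈ D`, then adding `b` to `C` and removing it from `D` both represent `2 * t + 1`.
    have h1 : ∑ i ∈ insert b C, a i = ∑ i ∈ D.erase b, a i := by
      rw [Finset.sum_insert hbC, hCt, hb1]
      have := Finset.add_sum_erase D a hbD
      rw [hDt, hb1] at this
      push_cast at this ⊢
      linear_combination -this
    have h2 := h (Finset.insert_subset hb (hC.trans (Finset.erase_subset b I)))
      ((Finset.erase_subset b D).trans hD) h1
    exact Finset.notMem_erase b D (h2 ▸ Finset.mem_insert_self b C)

section ZMod

variable {ι : Type*} {N : ℕ} [NeZero N] {I : Finset ι} {a : ι → ZMod N}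

theorem DistinctSums.mem_subsetSums_iff_val_lt (h : DistinctSums I a)
    (hN : 2 ^ I.card ≤ N) (hS : ∀ t : ℕ, t < 2 ^ I.card → (t : ZMod N) ∈ subsetSums I a) {x : ZMod N} :
    x ∈ subsetSums I a ↔ x.val < 2 ^ I.card := by
  have hsub : (Finset.range (2 ^ I.card)).image (fun t : ℕ => (t : ZMod N)) ⊆ subsetSums I a := by
    intro x hx
    obtain ⟨t, ht, rfl⟩ := Finset.mem_image.1 hx
    exact hS t (Finset.mem_range.1 ht)
  have hcard : ((Finset.range (2 ^ I.card)).image (fun t : ℕ => (t : ZMod N))).card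
      = 2 ^ I.card := by
    rw [Finset.card_image_of_injOn, Finset.card_range]
    intro s hs t ht hst
    simp only [Finset.coe_range, Set.mem_Iio] at hs ht
    have := congrArg ZMod.val hst
    simpa [ZMod.val_cast_of_lt (hs.trans_le hN), ZMod.val_cast_of_lt (ht.trans_le hN)] using this
  rw [← Finset.eq_of_subset_of_card_le hsub (by rw [hcard, h.card_subsetSums])]
  constructor
  · intro hx
    obtain ⟨t, ht, rfl⟩ := Finset.mem_image.1 hx
    have ht := Finset.mem_range.1 ht
    simpa [ZMod.val_cast_of_lt (ht.trans_le hN)] using ht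
  · intro hx
    exact Finset.mem_image.2 ⟨x.val, Finset.mem_range.2 hx, by simp⟩

/-- If the subset sums fill an interval that is at most half of the circle, nothing wraps
around. -/
theorem DistinctSums.exists_eq_one_of_two_mul_le [DecidableEq ι] (h : DistinctSums I a)
    (hI : I.Nonempty) (hN : 2 * 2 ^ I.card ≤ N)
    (hS : ∀ t : ℕ, t < 2 ^ I.card → (t : ZMod N) ∈ subsetSums I a) : ∃ b ∈ I, a b = 1 := by
  have hmem : ∀ C ⊆ I, (∑ i ∈ C, a i).val < 2 ^ I.card := fun C hC =>
    (h.mem_subsetSums_iff_val_lt (by omega) hS).1 (mem_subsetSums.2 ⟨C, hC, rfl⟩)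
  -- Two values below `2 ^ I.card ≤ N / 2` add without reduction modulo `N`.
  have hval : ∀ C ⊆ I, (∑ i ∈ C, a i).val = ∑ i ∈ C, (a i).val := by
    intro C
    induction C using Finset.induction_on with
    | empty => simp
    | insert i C hi ih =>
      intro hC
      have hC' : C ⊆ I := (Finset.subset_insert i C).trans hC
      have h1 := hmem C hC'
      have h2 := hmem {i} (Finset.singleton_subset_iff.2 (hC (Finset.mem_insert_self i C)))
      rw [Finset.sum_singleton] at h2
      rw [Finset.sum_insert hi, Finset.sum_insert hi, ZMod.val_add_of_lt (by omega), ih hC']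
  have h1 : 1 < 2 ^ I.card := Nat.one_lt_two_pow (Finset.card_ne_zero.2 hI)
  obtain ⟨B, hB, hB1⟩ := mem_subsetSums.1 (hS 1 h1)
  have hBv := hval B hB
  rw [hB1, ZMod.val_cast_of_lt (by omega)] at hBv
  obtain ⟨b, hb, hb0⟩ : ∃ b ∈ B, (a b).val ≠ 0 :=
    Finset.exists_ne_zero_of_sum_ne_zero (by omega)
  refine ⟨b, hB hb, ?_⟩
  have hle : (a b).val ≤ ∑ i ∈ B, (a i).val :=
    Finset.single_le_sum (f := fun i => (a i).val) (fun _ _ => Nat.zero_le _) hb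
  have hv : (a b).val = 1 := by omega
  rw [← ZMod.natCast_zmod_val (a b), hv, Nat.cast_one]

/-- Remove the summand `1` and halve the rest. `hone` is a separate hypothesis because the top-level
interval exceeds half of the circle; at lower levels `DistinctSums.exists_eq_one_of_two_mul_le`
supplies it. -/
theorem DistinctSums.image_eq_two_pow [DecidableEq ι] (hodd : Odd N) (n : ℕ) (hn : I.card = n)
    (h : DistinctSums I a) (hS : ∀ t : ℕ, t < 2 ^ n → (t : ZMod N) ∈ subsetSums I a)
    (hN : 2 ^ n < N) (hone : I.Nonempty → ∃ b ∈ I, a b = 1) :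
    I.image a = (Finset.range n).image fun i => (2 : ZMod N) ^ i := by
  induction n generalizing I a with
  | zero => simp [Finset.card_eq_zero.1 hn]
  | succ n ih =>
    obtain ⟨b, hb, hb1⟩ := hone (Finset.card_pos.1 (by omega))
    have h2 : IsUnit (2 : ZMod N) := by
      have := (ZMod.isUnit_iff_coprime 2 N).2 (Nat.coprime_two_left.2 hodd)
      simpa using this
    obtain ⟨u, hu⟩ := h2
    have hcard : (I.erase b).card = n := by rw [Finset.card_erase_of_mem hb, hn]; rfl
    have h' : DistinctSums (I.erase b) fun i => (↑u⁻¹ : ZMod N) * a i :=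
      (h.mono (Finset.erase_subset b I)).unit_mul (Units.isUnit _)
    have hS' : ∀ t : ℕ, t < 2 ^ n →
        (t : ZMod N) ∈ subsetSums (I.erase b) fun i => (↑u⁻¹ : ZMod N) * a i := by
      intro t ht
      have := h.two_mul_mem_subsetSums_erase (hn ▸ hS) hb hb1 (t := t)
        (by rw [hn, pow_succ]; omega)
      rw [← mem_subsetSums_unit_mul (Units.isUnit u⁻¹)] at this
      rwa [Nat.cast_mul, Nat.cast_two, ← hu, Units.inv_mul_cancel_left] at this
    have key := ih hcard h' hS' (by rw [pow_succ] at hN; omega) fun hne =>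
      h'.exists_eq_one_of_two_mul_le hne (by rw [hcard]; rw [pow_succ] at hN; omega)
        (hcard.symm ▸ hS')
    have hinv : ∀ x : ZMod N, 2 * ((↑u⁻¹ : ZMod N) * x) = x := fun x => by
      rw [← hu, Units.mul_inv_cancel_left]
    have key' := congrArg (Finset.image fun x : ZMod N => 2 * x) key
    simp only [Finset.image_image, Function.comp_def, hinv] at key'
    rw [← Finset.insert_erase hb, Finset.image_insert, hb1, Finset.range_add_one',
      Finset.image_insert, Finset.map_eq_image, Finset.image_image, key']
    rw [pow_zero]
    congr 1
    exact Finset.image_congr fun i _ => (pow_succ' 2 i).symm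

end ZMod

/-! ### Boundary functions along the multiples of a unit. -/

section Boundary

variable {N : ℕ} [NeZero N]

/-- A function on `ZMod N` whose antisymmetrized translate by a unit is `δ 0 - δ (-3)` alternates
along multiples of the unit up to `-3` and vanishes afterwards. -/
theorem alternating_of_add_translate {g : ZMod N → ℤ} {b : ZMod N} (hb : IsUnit b) (hN : 3 < N)
    (hg : ∀ x, g x + g (x - b) = (if x = 0 then 1 else 0) - (if x = -3 then 1 else 0))
    (h0 : g 0 = 1) :
    ∃ m < N, (m : ZMod N) * b = -3 ∧ (∀ j < m, g (j * b) = (-1) ^ j) ∧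
      ∀ j, m ≤ j → j < N → g (j * b) = 0 := by
  have hinj : ∀ i j : ℕ, i < N → j < N → (i : ZMod N) * b = j * b → i = j := by
    intro i j hi hj hij
    have := congrArg ZMod.val (hb.mul_right_cancel hij)
    simpa [ZMod.val_cast_of_lt hi, ZMod.val_cast_of_lt hj] using this
  obtain ⟨c, hc⟩ := hb
  obtain ⟨m, hmN, hm⟩ : ∃ m < N, (m : ZMod N) * b = -3 :=
    ⟨(-3 * (↑c⁻¹ : ZMod N)).val, ZMod.val_lt _, by
      rw [ZMod.natCast_zmod_val, ← hc, mul_assoc, Units.inv_mul, mul_one]⟩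
  have hstep : ∀ j : ℕ, j + 1 < N → j + 1 ≠ m →
      g ((j + 1 : ℕ) * b) + g (j * b) = 0 := by
    intro j hj hjm
    have h := hg ((j + 1 : ℕ) * b)
    have h1 : ((j + 1 : ℕ) : ZMod N) * b ≠ 0 := fun h1 =>
      absurd (hinj (j + 1) 0 hj (by omega) (by simpa using h1)) (by omega)
    have h2 : ((j + 1 : ℕ) : ZMod N) * b ≠ -3 := fun h2 =>
      hjm (hinj _ _ hj hmN (h2.trans hm.symm))
    rw [if_neg h1, if_neg h2, show ((j + 1 : ℕ) : ZMod N) * b - b = j * b by push_cast; ring]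
      at h
    simpa using h
  refine ⟨m, hmN, hm, ?_, ?_⟩
  · intro j
    induction j with
    | zero => intro _; simpa using h0
    | succ j ih =>
      intro hj
      have := hstep j (by omega) (by omega)
      rw [ih (by omega)] at this
      rw [pow_succ]
      linarith
  -- Descending induction from `j = N - 1`, where `j * b = -b` and the relation at `0` forces the
  -- value `0`.
  · have hdown : ∀ i j : ℕ, i + j + 1 = N → m ≤ j → g (j * b) = 0 := by
      intro i
      induction i with
      | zero =>
        intro j hj _
        have h := hg 0
        have h3 : (0 : ZMod N) ≠ -3 := by
          intro h3
          have : ((3 : ℕ) : ZMod N) = 0 := by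
            rw [← neg_eq_zero]; exact_mod_cast h3.symm
          rw [ZMod.natCast_eq_zero_iff] at this
          exact absurd (Nat.le_of_dvd (by omega) this) (by omega)
        have hj' : (0 : ZMod N) - b = j * b := by
          have : ((j + 1 : ℕ) : ZMod N) = 0 := by
            rw [show j + 1 = N by omega]; simp
          push_cast at this
          linear_combination (-b) * this
        rw [if_pos rfl, if_neg h3, h0, hj'] at h
        linarith
      | succ i ih =>
        intro j hj hmj
        have h1 := ih (j + 1) (by omega) (by omega)
        have h2 := hstep j (by omega) (by omega)
        linarith
    intro j hmj hj
    exact hdown (N - 1 - j) j (by omega) hmj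

/-- If moreover the function takes the values `1, -1` at `0, 1` and vanishes at `-1`, then it
cannot take the values `-1, 0, 1` at consecutive points. -/
theorem not_neg_one_zero_one_of_add_translate {g : ZMod N → ℤ} {b : ZMod N} (hb : IsUnit b)
    (hN : 3 < N)
    (hg : ∀ x, g x + g (x - b) = (if x = 0 then 1 else 0) - (if x = -3 then 1 else 0))
    (h0 : g 0 = 1) (h1 : g 1 = -1) (hneg : g (-1) = 0) {x : ZMod N} (hx : g x = -1)
    (hx1 : g (x + 1) = 0) : g (x + 2) ≠ 1 := by
  obtain ⟨m, hmN, hm, halt, hzero⟩ := alternating_of_add_translate hb hN hg h0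
  have hrep : ∀ y : ZMod N, ∃ j < N, (j : ZMod N) * b = y := by
    intro y
    obtain ⟨c, hc⟩ := hb
    exact ⟨(y * (↑c⁻¹ : ZMod N)).val, ZMod.val_lt _, by
      rw [ZMod.natCast_zmod_val, ← hc, mul_assoc, Units.inv_mul, mul_one]⟩
  have hlt : ∀ j < N, g (j * b) ≠ 0 → j < m := fun j hj h => by
    by_contra hmj
    exact h (hzero j (not_lt.1 hmj) hj)
  have hge : ∀ j : ℕ, g (j * b) = 0 → m ≤ j := fun j h => by
    by_contra hmj
    rw [halt j (not_le.1 hmj)] at h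
    exact pow_ne_zero j (by norm_num) h
  obtain ⟨k, hkN, hk⟩ := hrep 1
  have hk0 : k ≠ 0 := by
    rintro rfl
    rw [Nat.cast_zero, zero_mul] at hk
    rw [← hk, h0] at h1
    norm_num at h1
  have hkm : k < m := hlt k hkN (by rw [hk, h1]; norm_num)
  have hkm' : m ≤ N - k := hge _ (by
    rw [Nat.cast_sub hkN.le, sub_mul, hk]; simpa using hneg)
  -- `(m + 3 * k) * b = -3 + 3 = 0`, and `k < m ≤ N - k` gives `0 < m + 3 * k < 2 * N`.
  have hsum : m + 3 * k = N := by
    have hdvd : N ∣ m + 3 * k := by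
      rw [← ZMod.natCast_eq_zero_iff]
      refine hb.mul_right_cancel ?_
      push_cast
      linear_combination hm + 3 * hk
    obtain ⟨q, hq⟩ := hdvd
    have : q = 1 := by
      have h3 : q < 2 := by
        by_contra h3
        have : N * 2 ≤ N * q := Nat.mul_le_mul_left N (not_lt.1 h3)
        omega
      have h4 : q ≠ 0 := by rintro rfl; omega
      omega
    rw [hq, this, mul_one]
  obtain ⟨j, hjN, hj⟩ := hrep x
  have hjm : j < m := hlt j hjN (by rw [hj, hx]; norm_num)
  have hjk : m ≤ j + k := hge _ (by push_cast; rw [add_mul, hj, hk, hx1])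
  -- The index stays in the zero range: `m ≤ j + 2 * k < m + 2 * k < N`.
  have h2 : g ((j + 2 * k : ℕ) * b) = 0 := hzero _ (by omega) (by omega)
  have h3 : ((j + 2 * k : ℕ) : ZMod N) * b = x + 2 := by
    push_cast
    linear_combination hj + 2 * hk
  rw [h3] at h2
  rw [h2]
  norm_num

end Boundary

section ZMod

variable {ι : Type*} [DecidableEq ι] {N : ℕ} [NeZero N] {I : Finset ι} {a : ι → ZMod N}

/-- If the subset sums fill an interval that misses three residues, the sums avoiding a unit
summand `a b` have no gap of length exactly two, provided that they contain `0` but not `1`. -/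
theorem DistinctSums.mem_of_mem_of_mem_of_notMem (h : DistinctSums I a) (hN : 3 < N)
    (hS : ∀ x, x ∈ subsetSums I a ↔ x.val + 3 < N) {b : ι} (hb : b ∈ I) (hu : IsUnit (a b))
    {B : Finset ι} (hB : B ⊆ I) (hBsum : ∑ i ∈ B, a i = 1) (hbB : b ∈ B)
    {C₀ C₁ C₂ C₃ : Finset ι} (h₀ : C₀ ⊆ I) (h₁ : C₁ ⊆ I) (h₂ : C₂ ⊆ I) (h₃ : C₃ ⊆ I)
    (e₁ : ∑ i ∈ C₁, a i = ∑ i ∈ C₀, a i + 1) (e₂ : ∑ i ∈ C₂, a i = ∑ i ∈ C₁, a i + 1)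
    (e₃ : ∑ i ∈ C₃, a i = ∑ i ∈ C₂, a i + 1) (hb₀ : b ∉ C₀) (hb₁ : b ∈ C₁) (hb₂ : b ∈ C₂) :
    b ∈ C₃ := by
  classical
  by_contra hb₃
  set T := subsetSums (I.erase b) a with hT
  have hTmem : ∀ C ⊆ I, (∑ i ∈ C, a i ∈ T ↔ b ∉ C) := by
    intro C hC
    rw [hT, mem_subsetSums]
    constructor
    · rintro ⟨D, hD, hDC⟩ hbC
      rw [← h (hD.trans (Finset.erase_subset b I)) hC hDC] at hbC
      exact absurd (hD hbC) (Finset.notMem_erase b I)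
    · intro hbC
      exact ⟨C, Finset.subset_erase.2 ⟨hC, hbC⟩, rfl⟩
  have hTS : ∀ x ∈ T, x ∈ subsetSums I a := by
    intro x hx
    obtain ⟨C, hC, rfl⟩ := mem_subsetSums.1 hx
    exact mem_subsetSums.2 ⟨C, hC.trans (Finset.erase_subset b I), rfl⟩
  have hshift : ∀ x, x - a b ∈ T ↔ x ∈ subsetSums I a ∧ x ∉ T := by
    intro x
    constructor
    · intro hx
      obtain ⟨C, hC, hCx⟩ := mem_subsetSums.1 hx
      have hbC : b ∉ C := fun hbC => absurd (hC hbC) (Finset.notMem_erase b I)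
      have hsub : insert b C ⊆ I := Finset.insert_subset hb (hC.trans (Finset.erase_subset b I))
      have hxs : ∑ i ∈ insert b C, a i = x := by
        rw [Finset.sum_insert hbC, hCx]; ring
      exact ⟨mem_subsetSums.2 ⟨_, hsub, hxs⟩, by
        rw [← hxs, hTmem _ hsub]; simp⟩
    · rintro ⟨hx, hxT⟩
      obtain ⟨C, hC, rfl⟩ := mem_subsetSums.1 hx
      rw [hTmem C hC, not_not] at hxT
      exact mem_subsetSums.2 ⟨C.erase b, Finset.erase_subset_erase b hC, by
        rw [← Finset.add_sum_erase C a hxT]; ring⟩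
  -- Every subset either avoids `b` or arises by adding `b` to one that does, so `S` is the disjoint
  -- union of `T` and `T + a b`; in indicators, `s x + s (x - a b) = σ x`.
  let s : ZMod N → ℤ := fun x => if x ∈ T then 1 else 0
  let σ : ZMod N → ℤ := fun x => if x ∈ subsetSums I a then 1 else 0
  have hs : ∀ x, s x + s (x - a b) = σ x := by
    intro x
    simp only [s, σ, hshift]
    by_cases hxT : x ∈ T
    · simp [hxT, hTS x hxT]
    · by_cases hxS : x ∈ subsetSums I a <;> simp [hxT, hxS]
  have hout : ∀ i : ℕ, 0 < i → i ≤ 3 → -(i : ZMod N) ∉ subsetSums I a := by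
    intro i hi hi3 hmem
    rw [hS] at hmem
    have : (-(i : ZMod N)) = ((N - i : ℕ) : ZMod N) := by
      rw [Nat.cast_sub (by omega)]; simp
    rw [this, ZMod.val_cast_of_lt (by omega)] at hmem
    omega
  have hσ : ∀ x, σ x - σ (x - 1) = (if x = 0 then 1 else 0) - (if x = -3 then 1 else 0) := by
    intro x
    obtain ⟨v, hv, rfl⟩ : ∃ v < N, (v : ZMod N) = x := ⟨x.val, x.val_lt, by simp⟩
    have hvS : ∀ w < N, σ (w : ZMod N) = if w + 3 < N then 1 else 0 := by
      intro w hw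
      simp only [σ, hS, ZMod.val_cast_of_lt hw]
    have hv0 : (v : ZMod N) = 0 ↔ v = 0 := by
      rw [ZMod.natCast_eq_zero_iff]
      exact ⟨fun h0 => Nat.eq_zero_of_dvd_of_lt h0 hv, by rintro rfl; exact dvd_zero N⟩
    have hv3 : (v : ZMod N) = -3 ↔ v + 3 = N :=
      ZMod.natCast_eq_neg_natCast_iff hv (i := 3) (by norm_num) (by omega)
    simp only [hv0, hv3]
    rcases Nat.eq_zero_or_pos v with rfl | hpos
    · have h1 : σ ((0 : ℕ) - 1) = 0 := if_neg (by simpa using hout 1 (by norm_num) (by norm_num))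
      rw [hvS 0 hv, h1, if_pos (by omega), if_pos rfl, if_neg (by omega)]
    · rw [show (v : ZMod N) - 1 = (v - 1 : ℕ) by rw [Nat.cast_sub hpos]; simp, hvS v hv,
        hvS (v - 1) (by omega)]
      split_ifs <;> first | rfl | omega
  have hsneg : ∀ i : ℕ, 0 < i → i ≤ 3 → s (-(i : ZMod N)) = 0 := fun i hi hi3 =>
    if_neg fun hmem => hout i hi hi3 (hTS _ hmem)
  have hsC : ∀ C ⊆ I, s (∑ i ∈ C, a i) = if b ∈ C then 0 else 1 := by
    intro C hC
    simp only [s, hTmem C hC]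
    split_ifs <;> simp_all
  have hs0 : s 0 = 1 := by simpa using hsC ∅ (Finset.empty_subset I)
  have hs1 : s 1 = 0 := by rw [← hBsum, hsC B hB, if_pos hbB]
  have hm1 : s (-1) = 0 := by simpa using hsneg 1 (by norm_num) (by norm_num)
  have hm2 : s (-2) = 0 := by simpa using hsneg 2 (by norm_num) (by norm_num)
  have v0 := hsC C₀ h₀
  have v1 := hsC C₁ h₁
  have v2 := hsC C₂ h₂
  have v3 := hsC C₃ h₃
  rw [if_neg hb₀] at v0
  rw [if_pos hb₁, e₁] at v1
  rw [if_pos hb₂, e₂, e₁] at v2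
  rw [if_neg hb₃, e₃, e₂, e₁] at v3
  -- The difference `s x - s (x - 1)` marks the ends of the runs of `T`; a gap of length exactly two
  -- reads `-1, 0, 1`.
  refine not_neg_one_zero_one_of_add_translate (g := fun x => s x - s (x - 1)) hu hN ?_ ?_ ?_ ?_
    (x := ∑ i ∈ C₀, a i + 1) ?_ ?_ ?_
  · intro x
    have := hs x
    have h2 := hs (x - 1)
    rw [← hσ x, ← this, ← h2, show x - a b - 1 = x - 1 - a b by ring]
    ring
  · simp [hs0, hm1]
  · simp [hs0, hs1]
  · rw [show (-1 : ZMod N) - 1 = -2 by ring, hm1, hm2]; rfl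
  · simp [v0, v1]
  · simp [v1, v2]
  · rw [show ∑ i ∈ C₀, a i + 1 + 2 = ∑ i ∈ C₀, a i + 1 + 1 + 1 by ring,
      show ∑ i ∈ C₀, a i + 1 + 1 + 1 - 1 = ∑ i ∈ C₀, a i + 1 + 1 by ring, v3, v2]
    rfl

end ZMod

/-! ### The summand `1` when three residues are missing. -/

section ZMod

variable {ι : Type*} [DecidableEq ι] {N : ℕ} [NeZero N] {I : Finset ι} {a : ι → ZMod N}

/-- If the subset sums of units fill an interval that misses three residues, then one of the
summands is `1`: the digits of the representation of `1` change at every step. -/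
theorem DistinctSums.exists_eq_one_of_add_three (h : DistinctSums I a) (hI : I.Nonempty)
    (hN : N = 2 ^ I.card + 3) (hS : ∀ x, x ∈ subsetSums I a ↔ x.val + 3 < N)
    (hu : ∀ b ∈ I, IsUnit (a b)) : ∃ b ∈ I, a b = 1 := by
  -- Evenness of `2 ^ I.card` lets `omega` pass from `2 * u < 2 ^ I.card` to `2 * u + 1 < 2 ^
  -- I.card`.
  obtain ⟨m, hm⟩ : ∃ m, 2 ^ I.card = 2 * (m + 1) := by
    obtain ⟨k, hk⟩ := Nat.exists_eq_succ_of_ne_zero (Finset.card_ne_zero.2 hI)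
    refine ⟨2 ^ k - 1, ?_⟩
    have := Nat.two_pow_pos k
    rw [hk, pow_succ]
    omega
  have hrep : ∀ t : ℕ, ∃ C : Finset ι, t < 2 ^ I.card → C ⊆ I ∧ ∑ i ∈ C, a i = t := by
    intro t
    by_cases ht : t < 2 ^ I.card
    · obtain ⟨C, hC⟩ := mem_subsetSums.1 ((hS t).2 (by
        rw [ZMod.val_cast_of_lt (by omega)]; omega))
      exact ⟨C, fun _ => hC⟩
    · exact ⟨∅, fun h => absurd h ht⟩
  choose C hC using hrep
  obtain ⟨hB, hBsum⟩ := hC 1 (by omega)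
  rw [Nat.cast_one] at hBsum
  set B := C 1 with hBdef
  have hodd : ∀ u, 2 * u < 2 ^ I.card → Disjoint (C (2 * u)) B → C (2 * u + 1) = C (2 * u) ∪ B := by
    intro u hu hd
    obtain ⟨h1, e1⟩ := hC (2 * u) hu
    obtain ⟨h2, e2⟩ := hC (2 * u + 1) (by omega)
    refine h h2 (Finset.union_subset h1 hB) ?_
    rw [Finset.sum_union hd, e1, e2, hBsum]
    push_cast
    rfl
  have heven : ∀ u, 2 * u < 2 ^ I.card → Disjoint (C (2 * u)) B := by
    intro u
    induction u with
    | zero =>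
      intro hu0
      obtain ⟨h1, e1⟩ := hC (2 * 0) hu0
      rw [h h1 (Finset.empty_subset I) (by simpa using e1)]
      exact Finset.disjoint_empty_left B
    | succ u ih =>
      intro hu1
      have hd := ih (by omega)
      obtain ⟨h0, e0⟩ := hC (2 * u) (by omega)
      obtain ⟨h1, e1⟩ := hC (2 * u + 1) (by omega)
      obtain ⟨h2, e2⟩ := hC (2 * (u + 1)) hu1
      obtain ⟨h3, e3⟩ := hC (2 * (u + 1) + 1) (by omega)
      -- An element of `B` lies outside `C (2 * u)` and inside `C (2 * u + 1)`; if it is still in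
      -- the next set, it must remain for one more step, since gaps of length two are excluded.
      have hsub : C (2 * (u + 1)) ∩ B ⊆ C (2 * (u + 1) + 1) := by
        intro b hb
        obtain ⟨hb2, hbB⟩ := Finset.mem_inter.1 hb
        refine h.mem_of_mem_of_mem_of_notMem (by omega) hS (hB hbB) (hu b (hB hbB)) hB hBsum hbB
          h0 h1 h2 h3 ?_ ?_ ?_ (fun hb0 => Finset.disjoint_left.1 hd hb0 hbB) ?_ hb2
        · rw [e0, e1]; push_cast; ring
        · rw [e1, e2]; push_cast; ring
        · rw [e2, e3]; push_cast; ring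
        · rw [hodd u (by omega) hd]
          exact Finset.mem_union_right _ hbB
      -- Both sides have sum `2 * u + 3` minus the sum over the intersection. The left side avoids
      -- the intersection and the right side contains it, so it is empty.
      have hkey : C (2 * (u + 1) + 1) \ (C (2 * (u + 1)) ∩ B) = C (2 * (u + 1)) ∪ B := by
        refine h (Finset.sdiff_subset.trans h3) (Finset.union_subset h2 hB) ?_
        have s1 := Finset.sum_sdiff (f := a) hsub
        have s2 := Finset.sum_union_inter (s₁ := C (2 * (u + 1))) (s₂ := B) (f := a)
        rw [e3] at s1
        rw [e2, hBsum] at s2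
        push_cast at s1 s2
        linear_combination s1 - s2
      rw [Finset.disjoint_iff_inter_eq_empty, Finset.eq_empty_iff_forall_notMem]
      intro b hb
      have hb' : b ∈ C (2 * (u + 1)) ∪ B :=
        Finset.mem_union_right _ (Finset.mem_inter.1 hb).2
      rw [← hkey] at hb'
      exact (Finset.mem_sdiff.1 hb').2 hb
  obtain ⟨b, hb⟩ : B.Nonempty := by
    rw [Finset.nonempty_iff_ne_empty]
    intro hB0
    rw [hB0, Finset.sum_empty] at hBsum
    have : Fact (1 < N) := ⟨by omega⟩
    exact zero_ne_one hBsum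
  refine ⟨b, hB hb, ?_⟩
  have hbI : {b} ⊆ I := Finset.singleton_subset_iff.2 (hB hb)
  -- The value of `a b` is represented by `{b}`. It cannot be even, as `{b}` meets `B`; being odd,
  -- its representation contains `B`, whence `B = {b}`.
  have hbt := (hS (a b)).1 (mem_subsetSums.2 ⟨{b}, hbI, by simp⟩)
  have ht : (a b).val < 2 ^ I.card := by omega
  obtain ⟨hCt, et⟩ := hC _ ht
  have hCb : C (a b).val = {b} := h hCt hbI (by simp [et])
  have hBb : B ⊆ {b} := by
    rcases Nat.even_or_odd' (a b).val with ⟨u, hv | hv⟩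
    · have := heven u (by omega)
      rw [← hv, hCb] at this
      exact absurd hb (Finset.disjoint_singleton_left.1 this)
    · have := hodd u (by omega) (heven u (by omega))
      rw [← hv, hCb] at this
      rw [this]
      exact Finset.subset_union_right
  rw [Finset.Subset.antisymm hBb (Finset.singleton_subset_iff.2 hb), Finset.sum_singleton] at hBsum
  exact hBsum

end ZMod

/-! ### Units via characters in characteristic 2 and 3. -/

section Characters

variable {ι : Type*} [DecidableEq ι] {N : ℕ} [NeZero N] {I : Finset ι} {a : ι → ZMod N}

/-- A nonunit of `ZMod N` is killed by a nontrivial additive character with values in a field of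
prescribed characteristic prime to `N`. -/
theorem exists_addChar_eq_one_of_not_isUnit (p : ℕ) [Fact p.Prime] (hp : ¬ p ∣ N) {x : ZMod N}
    (hx : ¬ IsUnit x) :
    ∃ ψ : AddChar (ZMod N) (AlgebraicClosure (ZMod p)), ψ ≠ 1 ∧ ψ x = 1 := by
  -- The character sends `1` to a primitive `g`-th root of unity, which exists because `p ∤ g`; it
  -- is trivial on `x` since `g ∣ x.val`.
  set g := Nat.gcd x.val N with hg
  have hgN : g ∣ N := Nat.gcd_dvd_right _ _
  have hg1 : g ≠ 1 := by
    intro h1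
    apply hx
    have := (ZMod.isUnit_iff_coprime x.val N).2 h1
    rwa [ZMod.natCast_zmod_val] at this
  have : NeZero (g : ZMod p) := ⟨by
    rw [Ne, ZMod.natCast_eq_zero_iff]
    exact fun hpg => hp (hpg.trans hgN)⟩
  obtain ⟨ζ, hζ⟩ := HasEnoughRootsOfUnity.exists_primitiveRoot (AlgebraicClosure (ZMod p)) g
  have hζN : ζ ^ N = 1 := (hζ.pow_eq_one_iff_dvd N).2 hgN
  refine ⟨AddChar.zmodChar N hζN, ?_, ?_⟩
  · rw [AddChar.zmod_char_ne_one_iff]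
    intro h1
    have h2 := AddChar.zmodChar_apply' hζN 1
    rw [Nat.cast_one, h1, pow_one] at h2
    rw [← h2] at hζ
    exact hg1 (hζ.unique IsPrimitiveRoot.one)
  · rw [AddChar.zmodChar_apply, hζ.pow_eq_one_iff_dvd]
    exact Nat.gcd_dvd_left _ _

theorem AddChar.map_sum {N : ℕ} {K : Type*} [CommRing K] (ψ : AddChar (ZMod N) K)
    (a : ι → ZMod N) (C : Finset ι) : ∏ i ∈ C, ψ (a i) = ψ (∑ i ∈ C, a i) := by
  induction C using Finset.induction_on with
  | empty => simp
  | insert i C hi ih =>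
    rw [Finset.prod_insert hi, Finset.sum_insert hi, AddChar.map_add_eq_mul, ih]

/-- Expanding the product gives the sum of `ψ` over the subset sums, each occurring once; the sum
over the whole group vanishes. -/
theorem DistinctSums.prod_one_add_addChar {K : Type*} [CommRing K] [IsDomain K]
    (h : DistinctSums I a) {ψ : AddChar (ZMod N) K} (hψ : ψ ≠ 1) :
    ∏ i ∈ I, (1 + ψ (a i)) + ∑ x ∈ (subsetSums I a)ᶜ, ψ x = 0 := by
  rw [← AddChar.sum_eq_zero_of_ne_one hψ, ← Finset.sum_add_sum_compl (subsetSums I a),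
    subsetSums, Finset.sum_image, Finset.prod_one_add]
  · congr 1
    exact Finset.sum_congr rfl fun C _ => AddChar.map_sum ψ a C
  · intro B hB C hC hBC
    exact h (Finset.mem_powerset.1 hB) (Finset.mem_powerset.1 hC) hBC

theorem AddChar.pow_card_zmod {N : ℕ} {K : Type*} [CommRing K] (ψ : AddChar (ZMod N) K) (x : ZMod N) :
    ψ x ^ N = 1 := by
  rw [← AddChar.map_nsmul_eq_pow]
  simp

/-- If only one residue is not a subset sum, all summands are units. -/
theorem DistinctSums.isUnit_of_compl_eq_singleton (h : DistinctSums I a) (hodd : Odd N)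
    {r : ZMod N} (hr : (subsetSums I a)ᶜ = {r}) {b : ι} (hb : b ∈ I) : IsUnit (a b) := by
  by_contra hu
  obtain ⟨ψ, hψ, hψb⟩ := exists_addChar_eq_one_of_not_isUnit 2
    (Nat.two_dvd_ne_zero.2 (Nat.odd_iff.1 hodd)) hu
  have key := h.prod_one_add_addChar hψ
  -- The factor `1 + ψ (a b) = 1 + 1` vanishes in characteristic 2, leaving `ψ r = 0`, impossible
  -- for a root of unity.
  rw [hr, Finset.prod_eq_zero hb (by rw [hψb, CharTwo.add_self_eq_zero]), Finset.sum_singleton,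
    zero_add] at key
  have := AddChar.pow_card_zmod ψ r
  rw [key, zero_pow (NeZero.ne N)] at this
  exact zero_ne_one this

theorem AddChar.sum_triple {N : ℕ} {K : Type*} [CommRing K] (ψ : AddChar (ZMod N) K) (hodd : Odd N)
    (r : ZMod N) {d : ZMod N} (hd : d ≠ 0) :
    ∑ x ∈ ({r - d, r, r + d} : Finset (ZMod N)), ψ x = ψ r * (ψ (-d) + 1 + ψ d) := by
  have h1 : r ≠ r + d := by simpa using hd
  have h2 : r - d ∉ ({r, r + d} : Finset (ZMod N)) := by
    have h2 : r - d ≠ r + d := by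
      intro h2
      have h3 : ((2 : ℕ) : ZMod N) * d = 0 := by push_cast; linear_combination -h2
      exact hd (((ZMod.isUnit_iff_coprime 2 N).2
        (Nat.coprime_two_left.2 hodd)).mul_right_eq_zero.1 h3)
    simp [hd, h2]
  rw [Finset.sum_insert h2, Finset.sum_pair h1, sub_eq_add_neg, AddChar.map_add_eq_mul,
    AddChar.map_add_eq_mul]
  ring

theorem AddChar.apply_ne_zero {K : Type*} [CommRing K] [IsDomain K] (ψ : AddChar (ZMod N) K)
    (x : ZMod N) : ψ x ≠ 0 := by
  intro h
  have := AddChar.pow_card_zmod ψ x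
  rw [h, zero_pow (NeZero.ne N)] at this
  exact zero_ne_one this

/-- If the residues that are not subset sums form a progression of length three and `3 ∤ N`, then
all summands are units. -/
theorem DistinctSums.isUnit_of_compl_eq_triple (h : DistinctSums I a) (hodd : Odd N)
    (h3 : ¬ 3 ∣ N) {r d : ZMod N} (hd : d ≠ 0)
    (hr : (subsetSums I a)ᶜ = {r - d, r, r + d}) {b : ι} (hb : b ∈ I) : IsUnit (a b) := by
  by_contra hu
  obtain ⟨ψ, hψ, hψb⟩ := exists_addChar_eq_one_of_not_isUnit 2
    (Nat.two_dvd_ne_zero.2 (Nat.odd_iff.1 hodd)) hu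
  have key := h.prod_one_add_addChar hψ
  rw [hr, Finset.prod_eq_zero hb (by rw [hψb, CharTwo.add_self_eq_zero]),
    AddChar.sum_triple ψ hodd r hd, zero_add] at key
  have key := (mul_eq_zero.1 key).resolve_left (AddChar.apply_ne_zero ψ r)
  have hmul : ψ (-d) * ψ d = 1 := by
    rw [← AddChar.map_add_eq_mul, neg_add_cancel, AddChar.map_zero_eq_one]
  -- From `ψ (-d) + 1 + ψ d = 0`, the value `ψ d` has order dividing both 3 and `N`, hence is `1`;
  -- but `1 + 1 + 1 ≠ 0` in characteristic 2.
  have hcube : ψ d ^ 3 = 1 := by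
    linear_combination (ψ d * (ψ d - 1)) * key - (ψ d - 1) * hmul
  have hone : ψ d = 1 := by
    have h1 := orderOf_dvd_of_pow_eq_one hcube
    have h2 := orderOf_dvd_of_pow_eq_one (AddChar.pow_card_zmod ψ d)
    rw [← orderOf_eq_one_iff]
    exact Nat.eq_one_of_dvd_coprimes ((Nat.Prime.coprime_iff_not_dvd Nat.prime_three).2 h3) h1 h2
  rw [hone, mul_one] at hmul
  rw [hmul, hone, CharTwo.add_self_eq_zero, zero_add] at key
  exact one_ne_zero key

/-- If the residues that are not subset sums form a progression of length three and `3 ∤ N`, then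
the common difference of the progression is a unit. -/
theorem DistinctSums.isUnit_difference_of_compl_eq_triple (h : DistinctSums I a) (hodd : Odd N)
    (h3 : ¬ 3 ∣ N) {r d : ZMod N} (hd : d ≠ 0)
    (hr : (subsetSums I a)ᶜ = {r - d, r, r + d}) : IsUnit d := by
  by_contra hu
  obtain ⟨ψ, hψ, hψd⟩ := exists_addChar_eq_one_of_not_isUnit 3 h3 hu
  have key := h.prod_one_add_addChar hψ
  have hmul : ψ (-d) * ψ d = 1 := by
    rw [← AddChar.map_add_eq_mul, neg_add_cancel, AddChar.map_zero_eq_one]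
  rw [hψd, mul_one] at hmul
  -- The missing residues contribute `3 * ψ r = 0`, so some `ψ (a b) = -1`. Its `N`-th power is
  -- `-1`, as `N` is odd, and also `1`: absurd in characteristic 3.
  have hthree : (3 : AlgebraicClosure (ZMod 3)) = 0 := by
    exact_mod_cast CharP.cast_eq_zero (AlgebraicClosure (ZMod 3)) 3
  rw [hr, AddChar.sum_triple ψ hodd r hd, hψd, hmul,
    show (1 + 1 + 1 : AlgebraicClosure (ZMod 3)) = 3 by norm_num, hthree, mul_zero, add_zero,
    Finset.prod_eq_zero_iff] at key
  obtain ⟨b, -, hb⟩ := key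
  have h1 := AddChar.pow_card_zmod ψ (a b)
  rw [eq_neg_of_add_eq_zero_right hb, hodd.neg_one_pow] at h1
  have h2 : (1 : AlgebraicClosure (ZMod 3)) = 0 := by linear_combination hthree + h1
  exact one_ne_zero h2

end Characters

/-! ### Missing residues and normalization. -/

theorem DistinctSums.card_compl_subsetSums {ι : Type*} {N : ℕ} [NeZero N] {I : Finset ι}
    {a : ι → ZMod N} (h : DistinctSums I a) : (subsetSums I a)ᶜ.card = N - 2 ^ I.card := by
  rw [Finset.card_compl, h.card_subsetSums, ZMod.card]

theorem sub_mem_subsetSums {ι R : Type*} [DecidableEq ι] [AddCommGroup R] [DecidableEq R]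
    {I : Finset ι} {a : ι → R} {x : R} (hx : x ∈ subsetSums I a) :
    ∑ i ∈ I, a i - x ∈ subsetSums I a := by
  obtain ⟨C, hC, rfl⟩ := mem_subsetSums.1 hx
  refine mem_subsetSums.2 ⟨I \ C, Finset.sdiff_subset, ?_⟩
  rw [eq_sub_iff_add_eq, Finset.sum_sdiff hC]

/-- Dilation and sign changes move the set of subset sums by any affine bijection that takes `0`
to a subset sum. -/
theorem DistinctSums.exists_signs_of_mem {ι : Type*} [DecidableEq ι] {N : ℕ}
    {I : Finset ι} {a : ι → ZMod N} (h : DistinctSums I a) (d : (ZMod N)ˣ) {c : ZMod N}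
    (hc : c ∈ subsetSums I a) :
    ∃ ε : ι → ℤˣ, DistinctSums I (fun i => (↑d⁻¹ : ZMod N) * (((ε i : ℤ) : ZMod N) * a i)) ∧
      ∀ x, x ∈ subsetSums I (fun i => (↑d⁻¹ : ZMod N) * (((ε i : ℤ) : ZMod N) * a i)) ↔
        d * x + c ∈ subsetSums I a := by
  obtain ⟨C, hC, rfl⟩ := mem_subsetSums.1 hc
  refine ⟨fun i => if i ∈ C then -1 else 1, ?_⟩
  have heq : (fun i => ((((if i ∈ C then -1 else 1 : ℤˣ) : ℤ)) : ZMod N) * a i) =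
      fun i => if i ∈ C then -a i else a i := by
    funext i
    split_ifs <;> simp
  have heq' := congrArg (fun f : ι → ZMod N => fun i => (↑d⁻¹ : ZMod N) * f i) heq
  rw [heq']
  refine ⟨(h.flip hC).unit_mul (Units.isUnit _), fun x => ?_⟩
  rw [← mem_subsetSums_flip hC, ← mem_subsetSums_unit_mul (x := d * x) (Units.isUnit d⁻¹),
    Units.inv_mul_cancel_left]

section Normalization

variable {ι : Type*} [DecidableEq ι] {N : ℕ} [NeZero N] {I : Finset ι} {a : ι → ZMod N}

/-- If exactly three residues are not subset sums, they form a progression. -/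
theorem DistinctSums.exists_compl_eq_triple (h : DistinctSums I a) (hI : I.Nonempty)
    (hodd : Odd N) (hcard : (subsetSums I a)ᶜ.card = 3) :
    ∃ r d, d ≠ 0 ∧ (subsetSums I a)ᶜ = {r - d, r, r + d} := by
  have htwo : IsUnit (2 : ZMod N) := by
    have := (ZMod.isUnit_iff_coprime 2 N).2 (Nat.coprime_two_left.2 hodd)
    simpa using this
  obtain ⟨u, hu⟩ := htwo
  set s := ∑ i ∈ I, a i with hs
  obtain ⟨r, hr⟩ : ∃ r, r + r = s := ⟨(↑u⁻¹ : ZMod N) * s, by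
    rw [← two_mul, ← hu, Units.mul_inv_cancel_left]⟩
  -- A subset with sum `s / 2` would have the same sum as its complement.
  have hrM : r ∉ subsetSums I a := by
    intro hrS
    obtain ⟨C, hC, hCr⟩ := mem_subsetSums.1 hrS
    have h1 : C = I \ C := by
      refine h hC Finset.sdiff_subset ?_
      have := Finset.sum_sdiff (f := a) hC
      rw [← hs, ← hr, hCr] at this
      rw [hCr]
      exact (add_right_cancel this).symm
    obtain ⟨i, hi⟩ := hI
    by_cases hiC : i ∈ C
    · have := hiC
      rw [h1] at this
      exact (Finset.mem_sdiff.1 this).2 hiC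
    · exact hiC (h1 ▸ Finset.mem_sdiff.2 ⟨hi, hiC⟩)
  obtain ⟨y, hyM, hyr⟩ := Finset.exists_mem_ne (by omega) r (s := (subsetSums I a)ᶜ)
  rw [Finset.mem_compl] at hyM
  have hd : y - r ≠ 0 := sub_ne_zero.2 hyr
  refine ⟨r, y - r, hd, (Finset.eq_of_subset_of_card_le ?_ ?_).symm⟩
  · have hzM : r - (y - r) ∉ subsetSums I a := by
      intro hz
      have := sub_mem_subsetSums hz
      rw [← hs, ← hr] at this
      exact hyM (by convert this using 1; ring)
    intro z hz
    simp only [Finset.mem_insert, Finset.mem_singleton] at hz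
    rw [Finset.mem_compl]
    rcases hz with rfl | rfl | rfl
    · exact hzM
    · exact hrM
    · rwa [add_sub_cancel]
  · rw [hcard, Finset.card_insert_of_notMem, Finset.card_pair]
    · exact fun h1 => hd (by linear_combination -h1)
    · have h2 : r - (y - r) ≠ r + (y - r) := by
        intro h2
        refine hd (u.isUnit.mul_left_cancel (b := y - r) (c := 0) ?_)
        rw [hu]
        linear_combination -h2
      rw [Finset.mem_insert, Finset.mem_singleton, not_or]
      exact ⟨fun h1 => hd (by linear_combination -h1), h2⟩

/-- The classification of the families of `n` residues modulo `2 ^ n + 1` or `2 ^ n + 3` with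
distinct subset sums: up to signs and dilation, they are the powers of `2`. -/
theorem DistinctSums.exists_unit_signs (h : DistinctSums I a) (hI : I.Nonempty)
    (hN : N = 2 ^ I.card + 1 ∨ N = 2 ^ I.card + 3) :
    ∃ (d : (ZMod N)ˣ) (ε : ι → ℤˣ),
      Set.InjOn (fun i => (↑d⁻¹ : ZMod N) * (((ε i : ℤ) : ZMod N) * a i)) I ∧
      I.image (fun i => (↑d⁻¹ : ZMod N) * (((ε i : ℤ) : ZMod N) * a i)) =
        (Finset.range I.card).image fun i => (2 : ZMod N) ^ i := by
  have heven : Even (2 ^ I.card) :=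
    (even_two).pow_of_ne_zero (Finset.card_ne_zero.2 hI)
  have hpos : 2 ≤ 2 ^ I.card := Nat.one_lt_two_pow (Finset.card_ne_zero.2 hI)
  have hodd : Odd N := by
    rcases hN with hN | hN <;> rw [hN]
    · exact heven.add_one
    · exact heven.add_odd (by decide)
  have hunit : ∀ e : ℤˣ, IsUnit ((e : ℤ) : ZMod N) := fun e =>
    e.isUnit.map (Int.castRingHom (ZMod N))
  rcases hN with hN | hN
  · obtain ⟨r, hr⟩ := Finset.card_eq_one.1
      (show (subsetSums I a)ᶜ.card = 1 by rw [h.card_compl_subsetSums]; omega)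
    obtain ⟨b, hb⟩ := hI
    obtain ⟨d, hd⟩ := h.isUnit_of_compl_eq_singleton hodd hr hb
    have hmem : ∀ x, x ∈ subsetSums I a ↔ x ≠ r := by
      intro x
      rw [Ne, ← Finset.mem_singleton, ← hr, Finset.mem_compl, not_not]
    have : Fact (1 < N) := ⟨by omega⟩
    -- The map `x ↦ d * x + (r + d)` takes `-1` to `r`, so `-1` becomes the missing residue. As `d =
    -- a b`, the normalized family contains `1` or `-1`, and `-1` is excluded.
    obtain ⟨ε, hε, hS⟩ := h.exists_signs_of_mem d (c := r + d)
      ((hmem _).2 (by simp))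
    refine ⟨d, ε, hε.injOn, hε.image_eq_two_pow hodd _ rfl ?_ (by omega) ?_⟩
    · intro t ht
      rw [hS, hmem]
      intro heq
      have h1 : (t : ZMod N) = -(1 : ℕ) := by
        refine d.isUnit.mul_left_cancel ?_
        push_cast
        linear_combination heq
      rw [ZMod.natCast_eq_neg_natCast_iff (by omega) (by norm_num) (by omega)] at h1
      omega
    · intro _
      refine ⟨b, hb, ?_⟩
      rcases Int.units_eq_one_or (ε b) with hεb | hεb
      · simp [hεb, ← hd]
      · exfalso
        refine (hmem _).1 ((hS (-1)).1 (mem_subsetSums.2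
          ⟨{b}, Finset.singleton_subset_iff.2 hb, ?_⟩)) ?_
        · simp [hεb, ← hd]
        · ring
  · obtain ⟨r, d, hd0, hr⟩ := h.exists_compl_eq_triple hI hodd
      (by rw [h.card_compl_subsetSums]; omega)
    have h3 : ¬ 3 ∣ N := by
      rw [hN, Nat.dvd_add_left (dvd_refl 3)]
      intro h3
      have := Nat.prime_three.dvd_of_dvd_pow h3
      omega
    have hunits : ∀ b ∈ I, IsUnit (a b) := fun b hb =>
      h.isUnit_of_compl_eq_triple hodd h3 hd0 hr hb
    obtain ⟨d, rfl⟩ := h.isUnit_difference_of_compl_eq_triple hodd h3 hd0 hr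
    -- The shift `r + 2 * d` matches `-1, -2, -3` with the missing `r + d, r, r - d`.
    have hmem : ∀ x, d * x + (r + 2 * d) ∈ subsetSums I a ↔ x.val + 3 < N := by
      intro x
      obtain ⟨v, hv, rfl⟩ : ∃ v < N, (v : ZMod N) = x := ⟨x.val, x.val_lt, by simp⟩
      have e : ∀ i : ℕ, d * (v : ZMod N) + (r + 2 * d) = r + (2 - i) * d ↔ (v : ZMod N) = -(i : ZMod N) := by
        intro i
        constructor
        · intro hi
          refine d.isUnit.mul_left_cancel ?_
          linear_combination hi
        · intro hi
          rw [hi]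
          ring
      have e1 := e 1
      have e2 := e 2
      have e3 := e 3
      rw [ZMod.natCast_eq_neg_natCast_iff hv (by norm_num) (by omega)] at e1 e2 e3
      push_cast at e1 e2 e3
      rw [show r + (2 - 1) * (d : ZMod N) = r + d by ring] at e1
      rw [show r + (2 - 2) * (d : ZMod N) = r by ring] at e2
      rw [show r + (2 - 3) * (d : ZMod N) = r - d by ring] at e3
      rw [← not_iff_not, ← Finset.mem_compl, hr, ZMod.val_cast_of_lt hv]
      simp only [Finset.mem_insert, Finset.mem_singleton, e1, e2, e3]
      omega
    obtain ⟨ε, hε, hS⟩ := h.exists_signs_of_mem d (c := r + 2 * d)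
      (by simpa using (hmem 0).2 (by rw [ZMod.val_zero]; omega))
    simp only [hmem] at hS
    refine ⟨d, ε, hε.injOn, hε.image_eq_two_pow hodd _ rfl ?_ (by omega) fun _ =>
      hε.exists_eq_one_of_add_three hI hN hS fun b hb =>
        (Units.isUnit _).mul ((hunit _).mul (hunits b hb))⟩
    intro t ht
    rw [hS, ZMod.val_cast_of_lt (by omega)]
    omega

end Normalization

/-! ### Back to sets of integers. -/

theorem sumsetDistinctMod_iff {N : ℕ} {A : Finset ℤ} :
    SumsetDistinctMod N A ↔ DistinctSums A (fun x : ℤ => (x : ZMod N)) := by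
  simp only [SumsetDistinctMod, DistinctSums, ← ZMod.intCast_eq_intCast_iff, Int.cast_sum]

theorem residuesMod_signedDilatedPowers (N n : ℕ) (l : ℤ) (ε : Fin n → ℤˣ) :
    residuesMod N (signedDilatedPowers n l ε) =
      Finset.univ.image fun i : Fin n => (l : ZMod N) * (((ε i : ℤ) : ZMod N) * 2 ^ (i : ℕ)) := by
  rw [residuesMod, signedDilatedPowers, Finset.image_image]
  refine Finset.image_congr fun i _ => ?_
  simp only [Function.comp_apply]
  push_cast
  ring

/-- Binary expansions are unique, and the sums stay below `2 ^ n ≤ N`. -/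
theorem distinctSums_two_pow {N n : ℕ} (hN : 2 ^ n ≤ N) :
    DistinctSums (Finset.univ : Finset (Fin n)) (fun i => (2 : ZMod N) ^ (i : ℕ)) := by
  intro B C _ _ hBC
  have hsum : ∀ D : Finset (Fin n), ∑ i ∈ D, 2 ^ (i : ℕ) = ∑ i ∈ D.map Fin.valEmbedding, 2 ^ i :=
    fun D => by simp
  have hlt : ∀ D : Finset (Fin n), ∑ i ∈ D.map Fin.valEmbedding, 2 ^ i < N := fun D =>
    (Nat.geomSum_lt le_rfl fun k hk => by
      obtain ⟨i, -, rfl⟩ := Finset.mem_map.1 hk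
      exact i.2).trans_le hN
  have hcast : ∀ D : Finset (Fin n), ∑ i ∈ D, (2 : ZMod N) ^ (i : ℕ) =
      ((∑ i ∈ D.map Fin.valEmbedding, 2 ^ i : ℕ) : ZMod N) := fun D => by simp
  rw [hcast, hcast, ZMod.natCast_eq_natCast_iff', Nat.mod_eq_of_lt (hlt B),
    Nat.mod_eq_of_lt (hlt C)] at hBC
  exact Finset.map_injective _ (Finset.geomSum_injective le_rfl hBC)

theorem DistinctSums.signs_mul {ι : Type*} [DecidableEq ι] {N : ℕ} {I : Finset ι}
    {a : ι → ZMod N} (h : DistinctSums I a) (ε : ι → ℤˣ) :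
    DistinctSums I fun i => ((ε i : ℤ) : ZMod N) * a i := by
  have hflip := h.flip (Finset.filter_subset (fun i => ε i = -1) I)
  intro B C hB hC hBC
  refine hflip hB hC ?_
  have key : ∀ D ⊆ I, ∑ i ∈ D, ((ε i : ℤ) : ZMod N) * a i =
      ∑ i ∈ D, if i ∈ I.filter (fun i => ε i = -1) then -a i else a i := by
    intro D hD
    refine Finset.sum_congr rfl fun i hi => ?_
    rcases Int.units_eq_one_or (ε i) with hε | hε <;> simp [hε, hD hi]
  rw [← key B hB, ← key C hC, hBC]

theorem theorem1p3 (n : ℕ) (hn : 1 ≤ n) (N : ℕ) (hN : N = 2 ^ n + 1 ∨ N = 2 ^ n + 3)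
    (A : Finset ℤ) (hA : A.card = n) :
    SumsetDistinctMod N A ↔
      ∃ (l : ℤ) (ε : Fin n → ℤˣ), Int.gcd l (N : ℤ) = 1 ∧
        residuesMod N A = residuesMod N (signedDilatedPowers n l ε) := by
  have : NeZero N := ⟨by rcases hN with hN | hN <;> rw [hN] <;> exact Nat.succ_ne_zero _⟩
  rw [sumsetDistinctMod_iff]
  simp only [residuesMod_signedDilatedPowers]
  constructor
  · intro h
    subst hA
    obtain ⟨d, ε, hinj, himg⟩ := h.exists_unit_signs (Finset.card_pos.1 hn) hN
    have hex : ∀ i : Fin A.card, ∃ x ∈ A,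
        (↑d⁻¹ : ZMod N) * (((ε x : ℤ) : ZMod N) * (x : ZMod N)) = 2 ^ (i : ℕ) := fun i =>
      Finset.mem_image.1 (himg ▸ Finset.mem_image_of_mem _ (Finset.mem_range.2 i.2))
    choose x hxA hx using hex
    have hl : (((d : ZMod N).val : ℤ) : ZMod N) = d := by simp
    have hxi : ∀ i, (x i : ZMod N) = d * (((ε (x i) : ℤ) : ZMod N) * 2 ^ (i : ℕ)) := by
      intro i
      have hsq : ((ε (x i) : ℤ) : ZMod N) * ((ε (x i) : ℤ) : ZMod N) = 1 := by
        rw [← Int.cast_mul, ← Units.val_mul, Int.units_mul_self, Units.val_one, Int.cast_one]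
      rw [← hx i, mul_left_comm, Units.mul_inv_cancel_left, ← mul_assoc, hsq, one_mul]
    refine ⟨(d : ZMod N).val, fun i => ε (x i), ?_, ?_⟩
    · rw [Int.gcd_natCast_natCast]
      exact ZMod.val_coe_unit_coprime d
    · rw [hl, residuesMod]
      ext y
      simp only [Finset.mem_image, Finset.mem_univ, true_and, ← hxi]
      constructor
      · rintro ⟨z, hz, rfl⟩
        have hz' := Finset.mem_image_of_mem
          (fun x : ℤ => (↑d⁻¹ : ZMod N) * (((ε x : ℤ) : ZMod N) * (x : ZMod N))) hz
        rw [himg] at hz'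
        obtain ⟨i, hi, hiz⟩ := Finset.mem_image.1 hz'
        refine ⟨⟨i, Finset.mem_range.1 hi⟩, ?_⟩
        rw [hinj (hxA ⟨i, Finset.mem_range.1 hi⟩) hz ((hx _).trans hiz)]
      · rintro ⟨i, rfl⟩
        exact ⟨x i, hxA i, rfl⟩
  · rintro ⟨l, ε, hl, himg⟩
    have hlu : IsUnit (l : ZMod N) := by
      rw [ZMod.coe_int_isUnit_iff_isCoprime, Int.isCoprime_iff_gcd_eq_one, Int.gcd_comm]
      exact hl
    have hd := ((distinctSums_two_pow (N := N) (n := n) (by omega)).signs_mul ε).unit_mul hlu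
    -- The right-hand residue set has `n` elements, so reduction cannot identify two of the `n`
    -- elements of `A`.
    have hA' : Set.InjOn (fun x : ℤ => (x : ZMod N)) A := by
      rw [← Finset.card_image_iff, hA]
      rw [residuesMod] at himg
      rw [himg, Finset.card_image_of_injOn hd.injOn, Finset.card_univ, Fintype.card_fin]
    rw [distinctSums_iff_image hA']
    rw [residuesMod] at himg
    rw [himg]
    exact (distinctSums_iff_image hd.injOn).1 hd
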